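/- Let $E,A\in\mathbb R^{n\times n}$, $B\in\mathbb R^{n\times m}$, $C\in\mathbb R^{p\times n}$, $D\in\mathbb R^{p\times m}$ and let $H(s)=C(sE-A)^{-1}B+D$ be the transfer function of the full-order model. Assume that $\det(sE-A)\neq 0$ whenever $\operatorname{Re}s\ge 0$ and that $H(s)\to 0$ as $|s|\to\infty$ (for nonsingular $E$ the latter means $D=0$). Let $H_r(s)=C_r(sE_r-A_r)^{-1}B_r+D_r$ be the transfer function of a reduced model with real matrices $E_r,A_r\in\mathbb R^{r\times r}$, $B_r\in\mathbb R^{r\times m}$, $C_r\in\mathbb R^{p\times r}$, $D_r\in\mathbb R^{p\times m}$ such that $\det(sE_r-A_r)\ne0$ whenever $\operatorname{Re}s\ge0$, and suppose that $H_r$ has the pole–residue form $$H_r(s)=\sum_{i=1}^r\frac{c_i b_i^T}{s-\lambda_i}$$ with pairwise distinct $\lambda_i\in\mathbb C$, $\operatorname{Re}\lambda_i<0$, and $c_i\in\mathbb C^p$, $b_i\in\mathbb C^m$. For a $p\times m$ matrix-valued function $G$ put $$\|G\|_{\mathcal H_2}=\Bigl(\frac1{2\pi}\int_{-\infty}^{\infty}\|G(\imath\omega)\|_F^2\,d\omega\Bigr)^{1/2},$$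 where $\|\cdot\|_F$ is the Frobenius norm. Then $\|H\|_{\mathcal H_2}$ and $\|H-H_r\|_{\mathcal H_2}$ are finite and $$\|H-H_r\|_{\mathcal H_2}^2=\|H\|_{\mathcal H_2}^2-2\sum_{k=1}^r c_k^TH(-\lambda_k)b_k+\sum_{k,\ell=1}^r\frac{(c_k^Tc_\ell)(b_\ell^Tb_k)}{-\lambda_k-\lambda_\ell}.$$ -/

import Mathlib

open scoped Matrix Topology

noncomputable section

/-- A real linear time-invariant (descriptor) system `E x' = A x + B u`, `y = C x + D u` of order
`n` with `m` inputs and `p` outputs. -/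
structure LTISystem (n m p : ℕ) where
  E : Matrix (Fin n) (Fin n) ℝ
  A : Matrix (Fin n) (Fin n) ℝ
  B : Matrix (Fin n) (Fin m) ℝ
  C : Matrix (Fin p) (Fin n) ℝ
  D : Matrix (Fin p) (Fin m) ℝ

namespace LTISystem

variable {n m p : ℕ}

/-- The matrix pencil `s E - A`. -/
def pencil (S : LTISystem n m p) (s : ℂ) : Matrix (Fin n) (Fin n) ℂ :=
  s • S.E.map Complex.ofReal - S.A.map Complex.ofReal

/-- The transfer function `H(s) = C (s E - A)⁻¹ B + D`. -/
def transfer (S : LTISystem n m p) (s : ℂ) : Matrix (Fin p) (Fin m) ℂ :=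
  S.C.map Complex.ofReal * (S.pencil s)⁻¹ * S.B.map Complex.ofReal + S.D.map Complex.ofReal

/-- All (finite) eigenvalues of the pencil `λ E - A` lie in the open left half-plane
(in particular the pencil is regular). -/
def IsStable (S : LTISystem n m p) : Prop :=
  ∀ s : ℂ, 0 ≤ s.re → (S.pencil s).det ≠ 0

/-- `H(s) → 0` as `s → ∞`. For nonsingular `E` this says `D = 0`. -/
def IsStrictlyProper (S : LTISystem n m p) : Prop :=
  Filter.Tendsto S.transfer (Bornology.cobounded ℂ) (𝓝 0)

/-- The transfer function of `S` has the pole-residue form `∑ i, c i (b i)ᵀ / (s - lam i)` with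
pairwise distinct `lam i`. -/
structure HasPoleResidueForm {r : ℕ} (S : LTISystem n m p) (lam : Fin r → ℂ)
    (c : Fin r → Fin p → ℂ) (b : Fin r → Fin m → ℂ) : Prop where
  distinct : Function.Injective lam
  expansion : ∀ s : ℂ, (S.pencil s).det ≠ 0 → (∀ i, s ≠ lam i) →
    S.transfer s = ∑ i, (s - lam i)⁻¹ • Matrix.vecMulVec (c i) (b i)

end LTISystem

section H2

attribute [local instance] Matrix.frobeniusNormedAddCommGroup

/-- Squared Frobenius norm of `G` on the imaginary axis, `ω ↦ ‖G(i ω)‖_F²`. -/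
def h2Density {m p : ℕ} (G : ℂ → Matrix (Fin p) (Fin m) ℂ) (ω : ℝ) : ℝ :=
  ‖G (Complex.I * ω)‖ ^ 2

end H2

/-- The `H₂` norm of `G` is finite. -/
def HasFiniteH2Norm {m p : ℕ} (G : ℂ → Matrix (Fin p) (Fin m) ℂ) : Prop :=
  MeasureTheory.Integrable (h2Density G)

/-- The `H₂` norm `((1 / 2π) ∫ ‖G(i ω)‖_F² dω)^(1/2)`. -/
def h2Norm {m p : ℕ} (G : ℂ → Matrix (Fin p) (Fin m) ℂ) : ℝ :=
  Real.sqrt (1 / (2 * Real.pi) * ∫ ω : ℝ, h2Density G ω)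

end

/-! Real coefficients give `conj H(iω) = H(-iω)`, so the squared Frobenius norm on the axis is the
sum over entries of `G(iω) G(-iω)`. This is a bilinear expression without conjugates, and the square
of `H - H_r` expands entrywise.

Every term containing `H_r` reduces to a pairing with a simple pole `λ`, `Re λ < 0`. For `f`
holomorphic on the closed right half-plane and `O(1/s)`, Cauchy's formula
(`IsRightHardy.integral_cauchy`) gives `∫ f(iω) / (-iω - λ) dω = 2π f(-λ)`. Taking for `f` an entry
of `H` gives the cross terms, and an entry of `H_r` the double sum. The two cross terms agree under
`ω ↦ -ω`, whence the factor 2.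

The decay of `H` needed here follows from `H(∞) = 0` by removing the singularity at infinity
(`isBigO_inv_of_tendsto_zero`). -/

open Complex MeasureTheory Filter Asymptotics Bornology

/-- `f` is holomorphic on the closed right half-plane and `O(1/s)` at infinity. -/
structure IsRightHardy (f : ℂ → ℂ) : Prop where
  differentiableOn : DifferentiableOn ℂ f {s | 0 ≤ s.re}
  isBigO : f =O[cobounded ℂ] fun s => s⁻¹

namespace IsRightHardy

variable {f g : ℂ → ℂ}

theorem sub (hf : IsRightHardy f) (hg : IsRightHardy g) : IsRightHardy fun s => f s - g s :=
  ⟨hf.1.sub hg.1, hf.2.sub hg.2⟩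

theorem const_mul (hf : IsRightHardy f) (a : ℂ) : IsRightHardy fun s => a * f s :=
  ⟨hf.1.const_mul a, hf.2.const_mul_left a⟩

theorem sum {ι : Type*} (t : Finset ι) {F : ι → ℂ → ℂ} (hF : ∀ i ∈ t, IsRightHardy (F i)) :
    IsRightHardy fun s => ∑ i ∈ t, F i s :=
  ⟨DifferentiableOn.fun_sum fun i hi => (hF i hi).1, by
    simpa only [Finset.sum_fn] using IsBigO.sum fun i hi => (hF i hi).2⟩

theorem inv_sub_const {a : ℂ} (ha : a.re < 0) : IsRightHardy fun s => (s - a)⁻¹ := by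
  refine ⟨fun s hs => ?_, ?_⟩
  · refine DifferentiableAt.differentiableWithinAt ?_
    refine DifferentiableAt.inv (by fun_prop) fun h => ?_
    rw [sub_eq_zero.1 h] at hs
    exact absurd ha (not_lt.2 hs)
  · refine IsBigO.inv_rev ?_ ?_
    · have h1 : (fun _ : ℂ => a) =o[cobounded ℂ] fun s => s :=
        isLittleO_const_left.2 (Or.inr tendsto_norm_cobounded_atTop)
      have h2 := h1.right_isBigO_sub
      exact h2
    · filter_upwards [eventually_ne_cobounded (0 : ℂ)] with s hs h
      exact absurd h hs

theorem continuous_imaginary (hf : IsRightHardy f) : Continuous fun ω : ℝ => f (I * ω) :=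
  hf.1.continuousOn.comp_continuous (by fun_prop) (by simp)

theorem continuous_imaginary_neg (hf : IsRightHardy f) :
    Continuous fun ω : ℝ => f (-(I * ω)) :=
  hf.1.continuousOn.comp_continuous (by fun_prop) (by simp)

end IsRightHardy

/-! ### Integrability on the imaginary axis -/

theorem tendsto_I_mul_cobounded : Tendsto (fun ω : ℝ => I * (ω : ℂ)) (cocompact ℝ) (cobounded ℂ) := by
  rw [← tendsto_norm_atTop_iff_cobounded]
  exact (tendsto_norm_cocompact_atTop (E := ℝ)).congr fun ω => by simp

theorem tendsto_neg_I_mul_cobounded :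
    Tendsto (fun ω : ℝ => -(I * (ω : ℂ))) (cocompact ℝ) (cobounded ℂ) := by
  rw [← tendsto_norm_atTop_iff_cobounded]
  exact (tendsto_norm_cocompact_atTop (E := ℝ)).congr fun ω => by simp

theorem integrable_of_isBigO_inv_sq {f : ℝ → ℂ} (hf : Continuous f)
    (h : f =O[cocompact ℝ] fun ω => (ω⁻¹) ^ 2) : Integrable f := by
  refine hf.locallyIntegrable.integrable_of_isBigO_cocompact (g := fun ω : ℝ => (1 + ω ^ 2)⁻¹)
    (h.trans ?_) (integrable_inv_one_add_sq.integrableAtFilter _)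
  -- For `|ω| ≥ 1` one has `1 + ω² ≤ 2ω²`.
  refine IsBigO.of_bound 2 ?_
  filter_upwards [tendsto_norm_cocompact_atTop.eventually_ge_atTop (1 : ℝ)] with ω hω
  have h1 : 1 ≤ ω ^ 2 := by
    rw [← sq_abs]; exact one_le_pow₀ hω
  rw [Real.norm_of_nonneg (by positivity), Real.norm_of_nonneg (by positivity), inv_pow,
    ← div_eq_mul_inv, inv_eq_one_div, div_le_div_iff₀ (by positivity) (by positivity)]
  linarith

theorem IsRightHardy.integrable_mul {f g : ℂ → ℂ} (hf : IsRightHardy f) (hg : IsRightHardy g) :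
    Integrable fun ω : ℝ => f (I * ω) * g (-(I * ω)) := by
  refine integrable_of_isBigO_inv_sq (hf.continuous_imaginary.mul hg.continuous_imaginary_neg) ?_
  have h := (hf.2.comp_tendsto tendsto_I_mul_cobounded).mul
    (hg.2.comp_tendsto tendsto_neg_I_mul_cobounded)
  refine h.trans (IsBigO.of_norm_le fun ω => le_of_eq ?_)
  simp [← sq]

/-! ### Cauchy's theorem and formula on the right half-plane -/

/-- Cauchy's theorem on the right half-plane. -/
theorem integral_imaginary_eq_zero {h : ℂ → ℂ} (hd : DifferentiableOn ℂ h {s | 0 ≤ s.re})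
    (hO : h =O[cobounded ℂ] fun s => (s⁻¹) ^ 2) : ∫ ω : ℝ, h (I * ω) = 0 := by
  have hint : Integrable fun ω : ℝ => h (I * ω) := by
    refine integrable_of_isBigO_inv_sq
      (hd.continuousOn.comp_continuous (by fun_prop) (by simp)) ?_
    refine (hO.comp_tendsto tendsto_I_mul_cobounded).trans (IsBigO.of_norm_le fun ω => ?_)
    simp
  have hlim : Tendsto (fun R : ℝ => ∫ ω in (-R)..R, h (I * ω)) atTop (𝓝 (∫ ω : ℝ, h (I * ω))) :=
    intervalIntegral_tendsto_integral hint tendsto_neg_atTop_atBot tendsto_id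
  refine tendsto_nhds_unique hlim ?_
  obtain ⟨C, hC⟩ := hO.bound
  obtain ⟨R₀, -, hR₀⟩ := ((atTop_basis (α := ℝ)).cobounded_of_norm (E := ℂ)).eventually_iff.1 hC
  have hC' : ∀ {R : ℝ} {s : ℂ}, R₀ ≤ R → 0 < R → R ≤ ‖s‖ → ‖h s‖ ≤ |C| * (R⁻¹) ^ 2 := by
    intro R s h0 hR hs
    refine (hR₀ (show R₀ ≤ ‖s‖ by linarith)).trans ?_
    rw [norm_pow, norm_inv]
    gcongr
    exact le_abs_self C
  -- The contour is the rectangle with corners `-iR` and `R + iR`. Off the axis its sides have total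
  -- length `4R`, and there `|h| ≤ |C| / R²`.
  have hz : Tendsto (fun R : ℝ => 4 * |C| * R⁻¹) atTop (𝓝 0) := by
    simpa using tendsto_inv_atTop_zero.const_mul (4 * |C|)
  refine squeeze_zero_norm' ?_ hz
  filter_upwards [eventually_ge_atTop R₀, eventually_gt_atTop 0] with R h0 hR
  have key := integral_boundary_rect_eq_zero_of_differentiableOn h (-(R * I)) (R + R * I) (by
    refine hd.mono fun s hs => ?_
    have := hs.1
    simp only [neg_re, mul_re, ofReal_re, I_re, mul_zero, ofReal_im, I_im, mul_one, sub_self,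
      neg_zero, add_re, add_zero, Set.mem_preimage, Set.uIcc_of_le hR.le, Set.mem_Icc] at this
    exact this.1)
  simp only [neg_re, mul_re, ofReal_re, I_re, mul_zero, ofReal_im, I_im, mul_one, sub_self,
    neg_zero, add_re, add_zero, neg_im, mul_im, add_im, zero_add, ofReal_neg, ofReal_zero,
    smul_eq_mul] at key
  have e : ∀ ω : ℝ, h (ω * I) = h (I * ω) := fun ω => by rw [mul_comm]
  simp only [e] at key
  have b1 : ‖∫ x in (0 : ℝ)..R, h (x + -(R : ℂ) * I)‖ ≤ |C| * (R⁻¹) ^ 2 * |R - 0| :=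
    intervalIntegral.norm_integral_le_of_norm_le_const fun x _ => hC' h0 hR (by
      refine le_trans ?_ (abs_im_le_norm _)
      simp [abs_of_pos hR])
  have b2 : ‖∫ x in (0 : ℝ)..R, h (x + (R : ℂ) * I)‖ ≤ |C| * (R⁻¹) ^ 2 * |R - 0| :=
    intervalIntegral.norm_integral_le_of_norm_le_const fun x _ => hC' h0 hR (by
      refine le_trans ?_ (abs_im_le_norm _)
      simp [abs_of_pos hR])
  have b3 : ‖∫ y in (-R)..R, h (R + (y : ℂ) * I)‖ ≤ |C| * (R⁻¹) ^ 2 * |R - -R| :=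
    intervalIntegral.norm_integral_le_of_norm_le_const fun x _ => hC' h0 hR (by
      refine le_trans ?_ (abs_re_le_norm _)
      simp [abs_of_pos hR])
  have hI : ‖∫ ω in (-R)..R, h (I * ω)‖ = ‖I * ∫ ω in (-R)..R, h (I * ω)‖ := by simp
  rw [hI, ← sub_eq_zero.1 key]
  refine (norm_add_le _ _).trans ((add_le_add (norm_sub_le _ _) le_rfl).trans ?_)
  rw [norm_mul, norm_I, one_mul]
  rw [sub_zero, abs_of_pos hR] at b1 b2
  rw [sub_neg_eq_add, abs_of_pos (by linarith : 0 < R + R)] at b3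
  refine (add_le_add (add_le_add b1 b2) b3).trans (le_of_eq ?_)
  field_simp
  ring

theorem integral_poisson_kernel {a : ℝ} (ha : 0 < a) (b : ℝ) :
    ∫ ω : ℝ, 2 * a / (a ^ 2 + (ω - b) ^ 2) = 2 * Real.pi := by
  have e : ∀ ω : ℝ, 2 * a / (a ^ 2 + (ω - b) ^ 2)
      = (fun x => 2 * a⁻¹ * (1 + (x / a) ^ 2)⁻¹) (ω - b) := by
    intro ω
    have : a ^ 2 + (ω - b) ^ 2 ≠ 0 := by positivity
    field_simp
  simp_rw [e]
  rw [integral_sub_right_eq_self (μ := volume) (fun x : ℝ => 2 * a⁻¹ * (1 + (x / a) ^ 2)⁻¹) b,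
    integral_const_mul, Measure.integral_comp_div (fun x => (1 + x ^ 2)⁻¹) a,
    integral_univ_inv_one_add_sq, abs_of_pos ha]
  simp only [smul_eq_mul]
  field_simp

/-- Cauchy's formula for the right half-plane. -/
theorem IsRightHardy.integral_cauchy {f : ℂ → ℂ} (hf : IsRightHardy f) {a : ℂ} (ha : a.re < 0) :
    ∫ ω : ℝ, f (I * ω) * (-(I * ω) - a)⁻¹ = 2 * Real.pi * f (-a) := by
  obtain ⟨μ, rfl⟩ : ∃ μ, a = -μ := ⟨-a, by simp⟩
  rw [neg_re, neg_lt_zero] at ha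
  rw [neg_neg]
  -- Subtracting the constant `f μ` would destroy the decay. The multiple of `1 / (s + conj μ)` with
  -- the same value at `μ` keeps it, and its pole lies in the left half-plane.
  set c : ℂ := f μ * (2 * μ.re) with hc
  set F : ℂ → ℂ := fun s => f s - c * (s - -(starRingEnd ℂ μ))⁻¹ with hF
  have hFH : IsRightHardy F := hf.sub ((inv_sub_const (by simpa using ha)).const_mul c)
  have hμ0 : ((2 * μ.re : ℝ) : ℂ) ≠ 0 := by exact_mod_cast (by positivity : 2 * μ.re ≠ 0)
  have hFμ : F μ = 0 := by
    simp only [hF, hc, sub_neg_eq_add, add_conj]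
    rw [mul_assoc, ← ofReal_ofNat, ← ofReal_mul, mul_inv_cancel₀ hμ0, mul_one, sub_self]
  have hnhds : {s : ℂ | 0 ≤ s.re} ∈ 𝓝 μ :=
    mem_of_superset ((isOpen_lt continuous_const continuous_re).mem_nhds ha)
      fun s (hs : 0 < s.re) => hs.le
  have hds : ∀ s, s ≠ μ → dslope F μ s = F s * (s - μ)⁻¹ := fun s hs => by
    rw [dslope_of_ne _ hs, slope_def_field, hFμ, sub_zero, div_eq_mul_inv]
  have hO : dslope F μ =O[cobounded ℂ] fun s => (s⁻¹) ^ 2 := by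
    have h1 : (fun s => (s - μ)⁻¹) =O[cobounded ℂ] fun s : ℂ => s⁻¹ := by
      refine IsBigO.inv_rev ?_ ?_
      · exact (isLittleO_const_left.2 (Or.inr tendsto_norm_cobounded_atTop) :
          (fun _ : ℂ => μ) =o[cobounded ℂ] fun s => s).right_isBigO_sub
      · filter_upwards [eventually_ne_cobounded (0 : ℂ)] with s hs h
        exact absurd h hs
    refine (hFH.2.mul h1).congr' ?_ ?_
    · filter_upwards [eventually_ne_cobounded μ] with s hs using (hds s hs).symm
    · exact Eventually.of_forall fun s => (sq _).symm
  have hd := (differentiableOn_dslope hnhds).2 hFH.1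
  have hzero := integral_imaginary_eq_zero hd hO
  have hne : ∀ ω : ℝ, I * ω ≠ μ := fun ω h => by
    rw [← h] at ha; simp at ha
  -- On the axis `-(s + conj μ)(s - μ) = |s - μ|²`, so the correction term becomes a Poisson kernel.
  have hP : ∀ ω : ℝ, f (I * ω) * (-(I * ω) - -μ)⁻¹
      = f μ * ((2 * μ.re / (μ.re ^ 2 + (ω - μ.im) ^ 2) : ℝ) : ℂ) - dslope F μ (I * ω) := by
    intro ω
    rw [hds _ (hne ω)]
    simp only [hF, hc]
    have h1 : I * ω - μ ≠ 0 := sub_ne_zero.2 (hne ω)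
    have h2 : -(I * ω) - -μ = -(I * ω - μ) := by ring
    have h3 : (((μ.re ^ 2 + (ω - μ.im) ^ 2 : ℝ)) : ℂ)
        = -((I * ω - -(starRingEnd ℂ μ)) * (I * ω - μ)) := by
      apply Complex.ext <;> simp [sq] <;> ring
    have h4 : (((μ.re ^ 2 + (ω - μ.im) ^ 2 : ℝ)) : ℂ) ≠ 0 := by
      exact_mod_cast (by positivity : μ.re ^ 2 + (ω - μ.im) ^ 2 ≠ 0)
    rw [h3] at h4
    have h5 : I * ω - -(starRingEnd ℂ μ) ≠ 0 := fun h => h4 (by rw [h]; simp)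
    rw [h2, ofReal_div, h3]
    push_cast
    field_simp
    ring
  have hpk := integral_poisson_kernel ha μ.im
  -- A non-integrable function has integral 0 by convention, so the value `2π` forces integrability.
  have hpi : Integrable fun ω : ℝ => 2 * μ.re / (μ.re ^ 2 + (ω - μ.im) ^ 2) :=
    Integrable.of_integral_ne_zero (by rw [hpk]; positivity)
  have hdi : Integrable fun ω : ℝ => dslope F μ (I * ω) := by
    refine integrable_of_isBigO_inv_sq
      (hd.continuousOn.comp_continuous (by fun_prop) (by simp)) ?_
    refine (hO.comp_tendsto tendsto_I_mul_cobounded).trans (IsBigO.of_norm_le fun ω => ?_)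
    simp
  simp_rw [hP]
  have hpi' : Integrable fun ω : ℝ =>
      f μ * ((2 * μ.re / (μ.re ^ 2 + (ω - μ.im) ^ 2) : ℝ) : ℂ) := hpi.ofReal.const_mul _
  rw [integral_sub hpi' hdi, hzero, sub_zero, integral_const_mul,
    integral_complex_ofReal, hpk]
  push_cast
  ring

/-! ### Analyticity and symmetry of transfer functions -/

namespace LTISystem

variable {n m p : ℕ}

/-- The pencil `X E - A` as a matrix of polynomials. -/
noncomputable def polyPencil (S : LTISystem n m p) : Matrix (Fin n) (Fin n) (Polynomial ℂ) :=
  Matrix.of fun i j => Polynomial.X * Polynomial.C (S.E i j : ℂ) - Polynomial.C (S.A i j : ℂ)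

theorem mapMatrix_polyPencil (S : LTISystem n m p) (s : ℂ) :
    (Polynomial.evalRingHom s).mapMatrix S.polyPencil = S.pencil s := by
  ext i j
  simp [polyPencil, pencil, mul_comm s]

theorem det_pencil (S : LTISystem n m p) (s : ℂ) :
    (S.pencil s).det = S.polyPencil.det.eval s := by
  rw [← mapMatrix_polyPencil, ← RingHom.map_det, Polynomial.coe_evalRingHom]

theorem adjugate_pencil (S : LTISystem n m p) (s : ℂ) (i j : Fin n) :
    (S.pencil s).adjugate i j = (S.polyPencil.adjugate i j).eval s := by
  rw [← mapMatrix_polyPencil, ← RingHom.map_adjugate]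
  simp

theorem transfer_apply (S : LTISystem n m p) (s : ℂ) (i : Fin p) (j : Fin m) :
    S.transfer s i j = ∑ k, (∑ l, (S.C i l : ℂ) *
      ((S.polyPencil.det.eval s)⁻¹ * (S.polyPencil.adjugate l k).eval s)) * (S.B k j : ℂ)
      + (S.D i j : ℂ) := by
  simp [transfer, Matrix.mul_apply, Matrix.inv_def, det_pencil, adjugate_pencil, Finset.mul_sum,
    Finset.sum_mul, mul_assoc, mul_left_comm]

theorem differentiableAt_transfer (S : LTISystem n m p) {s : ℂ} (hs : (S.pencil s).det ≠ 0)
    (i : Fin p) (j : Fin m) : DifferentiableAt ℂ (fun s => S.transfer s i j) s := by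
  rw [det_pencil] at hs
  simp only [transfer_apply]
  have h : DifferentiableAt ℂ (fun s => (S.polyPencil.det.eval s)⁻¹) s :=
    S.polyPencil.det.differentiable.differentiableAt.inv hs
  refine DifferentiableAt.add_const _ (DifferentiableAt.fun_sum fun k _ => ?_)
  refine DifferentiableAt.mul_const (DifferentiableAt.fun_sum fun l _ => ?_) _
  exact (h.mul (Polynomial.differentiable _).differentiableAt).const_mul _

theorem IsStable.eventually_det_ne_zero {S : LTISystem n m p} (hS : S.IsStable) :
    ∀ᶠ s in cobounded ℂ, (S.pencil s).det ≠ 0 := by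
  have h0 : S.polyPencil.det ≠ 0 := fun h => hS 0 (by simp) (by rw [det_pencil, h]; simp)
  have hfin := Polynomial.finite_setOfPred_isRoot h0
  filter_upwards [isBounded_def.1 (Set.Finite.isBounded hfin)] with s hs
  rw [det_pencil]
  exact hs

theorem pencil_conj (S : LTISystem n m p) (s : ℂ) :
    S.pencil (starRingEnd ℂ s) = (S.pencil s).map (starRingEnd ℂ) := by
  ext i j
  simp [pencil]

theorem transfer_conj (S : LTISystem n m p) (s : ℂ) (i : Fin p) (j : Fin m) :
    S.transfer (starRingEnd ℂ s) i j = starRingEnd ℂ (S.transfer s i j) := by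
  -- Valid even at singular pencils: conjugation commutes with determinant and adjugate, and a
  -- singular matrix has inverse 0.
  have hinv : (S.pencil (starRingEnd ℂ s))⁻¹ = ((S.pencil s)⁻¹).map (starRingEnd ℂ) := by
    have hd : ((S.pencil s).map (starRingEnd ℂ)).det = starRingEnd ℂ (S.pencil s).det :=
      (RingHom.map_det _ _).symm
    have ha : ((S.pencil s).map (starRingEnd ℂ)).adjugate
        = (S.pencil s).adjugate.map (starRingEnd ℂ) :=
      (RingHom.map_adjugate _ _).symm
    ext a b
    rw [pencil_conj, Matrix.inv_def, Matrix.inv_def, hd, ha]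
    simp
  simp only [transfer, hinv, Matrix.add_apply, Matrix.mul_apply, Matrix.map_apply, map_add,
    map_sum, map_mul, conj_ofReal]

theorem transfer_neg_imaginary (S : LTISystem n m p) (ω : ℝ) (i : Fin p) (j : Fin m) :
    S.transfer (-(I * ω)) i j = starRingEnd ℂ (S.transfer (I * ω) i j) := by
  rw [← transfer_conj]
  simp

end LTISystem

/-- The function `w ↦ f(1/w)`, given the value 0 at 0, has a removable singularity there. It is thus
differentiable at 0, hence `O(w)`. -/
theorem isBigO_inv_of_tendsto_zero {f : ℂ → ℂ} (hd : ∀ᶠ s in cobounded ℂ, DifferentiableAt ℂ f s)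
    (h0 : Tendsto f (cobounded ℂ) (𝓝 0)) : f =O[cobounded ℂ] fun s => s⁻¹ := by
  set g : ℂ → ℂ := Function.update (fun w => f w⁻¹) 0 0 with hg
  have hg0 : g 0 = 0 := by simp [hg]
  have hgne : ∀ w, w ≠ 0 → g w = f w⁻¹ := fun w hw => by simp [hg, hw]
  have hcont : ContinuousAt g 0 := by
    rw [hg, continuousAt_update_same]
    exact h0.comp tendsto_inv₀_nhdsNE_zero
  have hdiff : ∀ᶠ w in 𝓝[≠] (0 : ℂ), DifferentiableAt ℂ g w := by
    filter_upwards [tendsto_inv₀_nhdsNE_zero.eventually hd, self_mem_nhdsWithin] with w hw hw0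
    have : DifferentiableAt ℂ (fun w => f w⁻¹) w :=
      DifferentiableAt.comp w hw (differentiableAt_inv hw0)
    refine this.congr_of_eventuallyEq ?_
    filter_upwards [isOpen_ne.mem_nhds hw0] with v hv using hgne v hv
  have hO := (analyticAt_of_differentiable_on_punctured_nhds_of_continuousAt
    hdiff hcont).differentiableAt.isBigO_sub
  simp only [hg0, sub_zero] at hO
  refine (hO.comp_tendsto tendsto_inv₀_cobounded).congr' ?_ EventuallyEq.rfl
  filter_upwards [eventually_ne_cobounded (0 : ℂ)] with s hs
  simp [hgne _ (inv_ne_zero hs)]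

theorem LTISystem.IsStable.isRightHardy_transfer {n m p : ℕ} {S : LTISystem n m p}
    (hS : S.IsStable) (hS0 : S.IsStrictlyProper) (i : Fin p) (j : Fin m) :
    IsRightHardy fun s => S.transfer s i j :=
  ⟨fun s hs => (S.differentiableAt_transfer (hS s hs) i j).differentiableWithinAt,
    isBigO_inv_of_tendsto_zero
      (hS.eventually_det_ne_zero.mono fun _ hs => S.differentiableAt_transfer hs i j)
      (tendsto_pi_nhds.1 (tendsto_pi_nhds.1 hS0 i) j)⟩

/-! ### Pairings with pole-residue sums -/

section PoleResidue

variable {f : ℂ → ℂ} {r : ℕ} {lam : Fin r → ℂ} {γ : Fin r → ℂ}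

theorem isRightHardy_poleResidue (hlam : ∀ k, (lam k).re < 0) (γ : Fin r → ℂ) :
    IsRightHardy fun s => ∑ k, γ k * (s - lam k)⁻¹ :=
  IsRightHardy.sum _ fun k _ => (IsRightHardy.inv_sub_const (hlam k)).const_mul _

theorem IsRightHardy.integral_mul_poleResidue (hf : IsRightHardy f) (hlam : ∀ k, (lam k).re < 0)
    (γ : Fin r → ℂ) :
    ∫ ω : ℝ, f (I * ω) * ∑ k, γ k * (-(I * ω) - lam k)⁻¹
      = 2 * Real.pi * ∑ k, γ k * f (-lam k) := by
  have h : ∀ ω : ℝ, f (I * ω) * ∑ k, γ k * (-(I * ω) - lam k)⁻¹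
      = ∑ k, γ k * (f (I * ω) * (-(I * ω) - lam k)⁻¹) := fun ω => by
    rw [Finset.mul_sum]
    exact Finset.sum_congr rfl fun k _ => by ring
  simp_rw [h]
  rw [integral_finsetSum _ fun k _ =>
    (hf.integrable_mul (inv_sub_const (hlam k))).const_mul (γ k), Finset.mul_sum]
  refine Finset.sum_congr rfl fun k _ => ?_
  rw [integral_const_mul, hf.integral_cauchy (hlam k)]
  ring

theorem integral_mul_neg_comm (f g : ℂ → ℂ) :
    ∫ ω : ℝ, f (I * ω) * g (-(I * ω)) = ∫ ω : ℝ, g (I * ω) * f (-(I * ω)) := by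
  rw [← integral_neg_eq_self]
  refine integral_congr_ae (Eventually.of_forall fun ω => ?_)
  simp [mul_comm]

theorem IsRightHardy.integral_sub_poleResidue (hf : IsRightHardy f)
    (hlam : ∀ k, (lam k).re < 0) (γ : Fin r → ℂ) :
    ∫ ω : ℝ, (f (I * ω) - ∑ k, γ k * (I * ω - lam k)⁻¹)
        * (f (-(I * ω)) - ∑ k, γ k * (-(I * ω) - lam k)⁻¹)
      = (∫ ω : ℝ, f (I * ω) * f (-(I * ω))) - 2 * (2 * Real.pi * ∑ k, γ k * f (-lam k))
        + 2 * Real.pi * ∑ k, γ k * ∑ l, γ l * (-lam k - lam l)⁻¹ := by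
  have hρ := isRightHardy_poleResidue hlam γ
  have h1 := hf.integral_mul_poleResidue hlam γ
  have h2 := hρ.integral_mul_poleResidue hlam γ
  have h3 := (integral_mul_neg_comm f fun s => ∑ k, γ k * (s - lam k)⁻¹).symm.trans h1
  have i0 := hf.integrable_mul hf
  have i1 := hf.integrable_mul hρ
  have i2 := hρ.integrable_mul hρ
  have i3 := hρ.integrable_mul hf
  -- The closed forms are turned back into integrals, one cross term by `h1` and the other by its
  -- reflection `h3`. What remains is additivity of the integral.
  rw [← h2, two_mul (2 * Real.pi * ∑ k, γ k * f (-lam k)), ← sub_sub]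
  nth_rw 1 [← h1]
  rw [← h3]
  refine Eq.trans (integral_congr_ae (Eventually.of_forall fun ω => ?_))
    ((integral_add' ((i0.sub i1).sub i3) i2).trans
      (congrArg (· + _) ((integral_sub' (i0.sub i1) i3).trans
        (congrArg (· - _) (integral_sub' i0 i1)))))
  simp only [Pi.add_apply, Pi.sub_apply]
  ring

end PoleResidue

/-! ### The `H₂` norm and the error formula -/

section H2

variable {m p : ℕ} {G : ℂ → Matrix (Fin p) (Fin m) ℂ}

theorem h2Density_eq_sum (G : ℂ → Matrix (Fin p) (Fin m) ℂ) (ω : ℝ) :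
    h2Density G ω = ∑ i, ∑ j, ‖G (I * ω) i j‖ ^ 2 := by
  rw [h2Density, Matrix.frobenius_norm_def, ← Real.sqrt_eq_rpow, Real.sq_sqrt (by positivity)]
  simp

theorem h2Norm_sq (G : ℂ → Matrix (Fin p) (Fin m) ℂ) :
    h2Norm G ^ 2 = 1 / (2 * Real.pi) * ∫ ω : ℝ, h2Density G ω := by
  rw [h2Norm, Real.sq_sqrt]
  exact mul_nonneg (by positivity) (integral_nonneg fun ω => by
    rw [h2Density_eq_sum]; simp only [Pi.zero_apply]; positivity)

/-- Parseval-type expression of the `H₂` norm of a real `G` that agrees on the imaginary axis with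
a matrix of functions `F i j` which are holomorphic on the right half-plane. -/
theorem hasFiniteH2Norm_and_h2Norm_sq {F : Fin p → Fin m → ℂ → ℂ}
    (hF : ∀ i j, IsRightHardy (F i j)) (hFG : ∀ (ω : ℝ) i j, G (I * ω) i j = F i j (I * ω))
    (hG : ∀ (ω : ℝ) i j, G (-(I * ω)) i j = starRingEnd ℂ (G (I * ω) i j)) :
    HasFiniteH2Norm G ∧ ((h2Norm G : ℝ) : ℂ) ^ 2
      = (2 * Real.pi : ℂ)⁻¹ * ∑ i, ∑ j, ∫ ω : ℝ, F i j (I * ω) * F i j (-(I * ω)) := by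
  have hFG' : ∀ (ω : ℝ) i j, F i j (-(I * ω)) = starRingEnd ℂ (G (I * ω) i j) := fun ω i j => by
    rw [← hG]
    simpa using (hFG (-ω) i j).symm
  have key : ∀ ω : ℝ, ((h2Density G ω : ℝ) : ℂ)
      = ∑ i, ∑ j, F i j (I * ω) * F i j (-(I * ω)) := fun ω => by
    rw [h2Density_eq_sum]
    push_cast
    refine Finset.sum_congr rfl fun i _ => Finset.sum_congr rfl fun j _ => ?_
    rw [hFG', ← hFG, mul_conj, normSq_eq_norm_sq]
    push_cast
    rfl
  have hi : ∀ i, Integrable fun ω : ℝ => ∑ j, F i j (I * ω) * F i j (-(I * ω)) := fun i =>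
    integrable_finsetSum _ fun j _ => (hF i j).integrable_mul (hF i j)
  constructor
  · have h : Integrable fun ω : ℝ => ((h2Density G ω : ℝ) : ℂ) := by
      simp_rw [key]
      exact integrable_finsetSum _ fun i _ => hi i
    exact h.re
  · rw [← ofReal_pow, h2Norm_sq, ofReal_mul, ← integral_complex_ofReal]
    simp_rw [key]
    rw [integral_finsetSum _ fun i _ => hi i]
    push_cast
    rw [one_div]
    congr 1
    refine Finset.sum_congr rfl fun i _ => ?_
    rw [integral_finsetSum _ fun j _ => (hF i j).integrable_mul (hF i j)]

end H2

theorem Finset.sum_sum_comm_sum_sum {ι κ α β M : Type*} [Fintype ι] [Fintype κ] [Fintype α]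
    [Fintype β] [AddCommMonoid M] (f : ι → κ → α → β → M) :
    ∑ k, ∑ l, ∑ i, ∑ j, f k l i j = ∑ i, ∑ j, ∑ k, ∑ l, f k l i j := by
  calc ∑ k, ∑ l, ∑ i, ∑ j, f k l i j = ∑ k, ∑ i, ∑ j, ∑ l, f k l i j :=
        Finset.sum_congr rfl fun k _ => Finset.sum_comm.trans
          (Finset.sum_congr rfl fun i _ => Finset.sum_comm)
    _ = ∑ i, ∑ j, ∑ k, ∑ l, f k l i j := Finset.sum_comm.trans
          (Finset.sum_congr rfl fun i _ => Finset.sum_comm)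

theorem mainTheorem5 {n r m p : ℕ}
    (S : LTISystem n m p) (hS : S.IsStable) (hS0 : S.IsStrictlyProper)
    (Sr : LTISystem r m p) (hSr : Sr.IsStable)
    (lam : Fin r → ℂ) (c : Fin r → Fin p → ℂ) (b : Fin r → Fin m → ℂ)
    (hlam : ∀ i, (lam i).re < 0) (hpr : Sr.HasPoleResidueForm lam c b) :
    HasFiniteH2Norm S.transfer ∧
    HasFiniteH2Norm (fun s => S.transfer s - Sr.transfer s) ∧
    ((h2Norm (fun s => S.transfer s - Sr.transfer s) : ℝ) : ℂ) ^ 2 =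
      ((h2Norm S.transfer : ℝ) : ℂ) ^ 2
        - 2 * ∑ k, c k ⬝ᵥ (S.transfer (-lam k) *ᵥ b k)
        + ∑ k, ∑ l, ((c k ⬝ᵥ c l) * (b l ⬝ᵥ b k)) / (-lam k - lam l) := by
  have hH := hS.isRightHardy_transfer hS0
  have hR : ∀ (ω : ℝ) i j, Sr.transfer (I * ω) i j
      = ∑ k, (c k i * b k j) * (I * ω - lam k)⁻¹ := fun ω i j => by
    rw [hpr.expansion _ (hSr _ (by simp)) fun k h => by
      have := hlam k
      rw [← h] at this
      simp at this, Matrix.sum_apply]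
    exact Finset.sum_congr rfl fun k _ => by simp [Matrix.vecMulVec_apply, mul_comm]
  obtain ⟨hfin, hnorm⟩ := hasFiniteH2Norm_and_h2Norm_sq (G := S.transfer) hH
    (fun _ _ _ => rfl) S.transfer_neg_imaginary
  -- The explicit pole-residue sum replaces `Sr.transfer` in `F`, since its holomorphy and decay are
  -- immediate from the location of the poles.
  obtain ⟨hfin', hnorm'⟩ := hasFiniteH2Norm_and_h2Norm_sq
    (G := fun s => S.transfer s - Sr.transfer s)
    (F := fun i j s => S.transfer s i j - ∑ k, (c k i * b k j) * (s - lam k)⁻¹)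
    (fun i j => (hH i j).sub (isRightHardy_poleResidue hlam _))
    (fun ω i j => by rw [Matrix.sub_apply, hR])
    (fun ω i j => by
      simp only [Matrix.sub_apply, S.transfer_neg_imaginary, Sr.transfer_neg_imaginary, map_sub])
  refine ⟨hfin, hfin', ?_⟩
  have hpi : (2 * Real.pi : ℂ) ≠ 0 := by simp [Real.pi_ne_zero]
  have hlin : ∑ k, c k ⬝ᵥ (S.transfer (-lam k) *ᵥ b k)
      = ∑ i, ∑ j, ∑ k, (c k i * b k j) * S.transfer (-lam k) i j := by
    simp only [dotProduct, Matrix.mulVec, Finset.mul_sum]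
    rw [Finset.sum_comm]
    refine Finset.sum_congr rfl fun i _ => ?_
    rw [Finset.sum_comm]
    exact Finset.sum_congr rfl fun j _ => Finset.sum_congr rfl fun k _ => by ring
  have hquad : ∑ k, ∑ l, ((c k ⬝ᵥ c l) * (b l ⬝ᵥ b k)) / (-lam k - lam l)
      = ∑ i, ∑ j, ∑ k, (c k i * b k j) * ∑ l, (c l i * b l j) * (-lam k - lam l)⁻¹ := by
    have e : ∀ i j, ∑ k, (c k i * b k j) * ∑ l, (c l i * b l j) * (-lam k - lam l)⁻¹
        = ∑ k, ∑ l, (c k i * c l i) * (b l j * b k j) * (-lam k - lam l)⁻¹ := fun i j =>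
      Finset.sum_congr rfl fun k _ => by
        rw [Finset.mul_sum]
        exact Finset.sum_congr rfl fun l _ => by ring
    simp_rw [e, dotProduct, Finset.sum_mul_sum, div_eq_mul_inv, Finset.sum_mul]
    exact Finset.sum_sum_comm_sum_sum fun k l i j =>
      c k i * c l i * (b l j * b k j) * (-lam k - lam l)⁻¹
  rw [hnorm', hnorm, hlin, hquad]
  simp_rw [fun i j => (hH i j).integral_sub_poleResidue hlam fun k => c k i * b k j,
    Finset.sum_add_distrib, Finset.sum_sub_distrib, ← Finset.mul_sum]
  field_simp
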